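/- Let $\mathcal A$ be a finite alphabet. For each agent $\ell\in\{1,\dots,S\}$ let $\pi_\ell$ be a probability mass function (PMF) on $\mathcal A$, and let $\mathbf x_\ell(i)$, $\ell=1,\dots,S$, $i\ge 1$, be mutually independent $\mathcal A$-valued observations, with $\mathbf x_\ell(i)$ distributed according to $\pi_\ell$ for every $i$. Let the data $\mathbf d_\ell^{(r)}(i)$, $r=1,\dots,R$, be of one of the following two types. (a) Informed agents: $\mathbf d_\ell^{(r)}(i)=\log p_r(\mathbf x_\ell(i))$, where $p_1,\dots,p_R$ are strictly positive PMFs on $\mathcal A$ and each $\pi_\ell$ is one of them. (b) Partially informed agents: $\mathcal A=\{a_1,\dots,a_R\}$ has $R$ letters, $\mathbf d_\ell^{(r)}(i)=1$ if $\mathbf x_\ell(i)=a_r$ and $\mathbf d_\ell^{(r)}(i)=0$ otherwise, and each $\pi_\ell$ is strictly positive. Fix an agent $k$ and, for a step size $\mu\in(0,1)$ and $1\le j\le i$, set $$\mathbf t_k^{(r)}(i,j)=\sqrt{\mu}\,(1-\mu)^{j-1}\sum_{\ell=1}^S b_{k\ell}\,\mathbf d_\ell^{(r)}(i-j+1),\qquad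 b_{k\ell}=\begin{cases}1,& k=\ell,\\ 0,& k\ne \ell,\end{cases}$$ $$\boldsymbol q_k(i,j)=\big[\mathbf t_k^{(1)}(i,j),\dots,\mathbf t_k^{(R)}(i,j)\big]^T,\qquad \mathbf z_k^{(r)}(i)=\sqrt{\mu}\sum_{j=1}^i \mathbf t_k^{(r)}(i,j),$$ so that $\mathbf z_k(i)=[\mathbf z_k^{(1)}(i),\dots,\mathbf z_k^{(R)}(i)]^T$ is the status of the isolated agent $k$ running the LMS recursion $\mathbf z_k^{(r)}(i)=\mathbf z_k^{(r)}(i-1)+\mu\,[\mathbf d_k^{(r)}(i)-\mathbf z_k^{(r)}(i-1)]$ from $\mathbf z_k^{(r)}(0)=0$. Let $\Lambda_k$ be the $R\times R$ matrix with entries $$[\Lambda_k]_{r_1r_2}=\mathbb E\Big[\big(\mathbf d_k^{(r_1)}-\mathbb E\,\mathbf d_k^{(r_1)}\big)\big(\mathbf d_k^{(r_2)}-\mathbb E\,\mathbf d_k^{(r_2)}\big)\Big],$$ where $\mathbf d_k^{(r)}$ stands for $\mathbf d_k^{(r)}(i)$ with any $i$, whose distribution does not depend on $i$. Then, in the limit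 $i\to\infty$ followed by $\mu\to0^+$, the sum $$\sum_{j=1}^i\big[\boldsymbol q_k(i,j)-\mathbb E\,\boldsymbol q_k(i,j)\big]=\frac{\mathbf z_k(i)-\mathbb E\,\mathbf z_k(i)}{\sqrt{\mu}}$$ converges in distribution to a zero-mean Gaussian vector with covariance matrix $\Lambda_k/2$. That is, for every $\mu\in(0,1)$ it converges in distribution, as $i\to\infty$, to some law $Q_\mu$ on $\mathbb R^R$, and $Q_\mu$ converges weakly to $\mathcal N_R(0,\Lambda_k/2)$ as $\mu\to0^+$. -/

import Mathlib

open MeasureTheory ProbabilityTheory Filter Topology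

noncomputable section

namespace AdaptiveDecision

/-- The two decision problems over a finite alphabet `A`, both with `R` branches.
* `informed p`: multi-hypothesis testing among the `R` known probability mass functions
  `p 0, …, p (R - 1)`.
* `partiallyInformed e`: event detection, where `e` enumerates the `R` letters of the alphabet. -/
inductive DecisionProblem (A : Type*) (R : ℕ) where
  | informed (p : Fin R → PMF A)
  | partiallyInformed (e : Fin R ≃ A)

/-- The statistic that the `r`-th branch computes from an observation `a`: the log-likelihood
`log p_r(a)` for informed agents, the indicator of `a` being the `r`-th letter for partially
informed agents. -/
def DecisionProblem.score {A : Type*} {R : ℕ} : DecisionProblem A R → Fin R → A → ℝ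
  | .informed p, r, a => Real.log (p r a).toReal
  | .partiallyInformed e, r, a => Set.indicator {e r} 1 a

/-- `D.Admits law`: in the problem `D`, the observations of agent `ℓ` may have distribution
`law ℓ`. Informed agents: the hypotheses are strictly positive and each agent observes data from
one of them. Partially informed agents: the data are drawn from arbitrary strictly positive
probability mass functions. -/
def DecisionProblem.Admits {A : Type*} {R S : ℕ} : DecisionProblem A R → (Fin S → PMF A) → Prop
  | .informed p, law => (∀ h a, 0 < p h a) ∧ ∀ ℓ, ∃ hstar, law ℓ = p hstar
  | .partiallyInformed _, law => ∀ ℓ a, 0 < law ℓ a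

variable {A Ω : Type*} {R S : ℕ}

/-- The data `d_k^{(r)}(i)` of agent `k` at time `i`. -/
def datum (D : DecisionProblem A R) (x : Fin S → ℕ → Ω → A) (k : Fin S) (r : Fin R) (i : ℕ)
    (ω : Ω) : ℝ :=
  D.score r (x k i ω)

/-- The entry `t_k^{(r)}(i,j) = √μ (1-μ)^{j-1} ∑_ℓ b_{kℓ}(j) d_ℓ^{(r)}(i-j+1)`, `1 ≤ j ≤ i`, for
general weights `b`. -/
def arrayEntry (b : ℕ → Matrix (Fin S) (Fin S) ℝ) (D : DecisionProblem A R)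
    (x : Fin S → ℕ → Ω → A) (k : Fin S) (μ : ℝ) (r : Fin R) (i j : ℕ) (ω : Ω) : ℝ :=
  √μ * (1 - μ) ^ (j - 1) * ∑ ℓ, b j k ℓ * datum D x ℓ r (i - j + 1) ω

/-- The weights of isolated agents: one if `k = ℓ` and zero otherwise. -/
def isolatedWeights (S : ℕ) : ℕ → Matrix (Fin S) (Fin S) ℝ :=
  fun _ => Matrix.of fun k ℓ => if k = ℓ then 1 else 0

/-- The vector `q_k(i,j) = (t_k^{(1)}(i,j), …, t_k^{(R)}(i,j))`. -/
def arrayVector (b : ℕ → Matrix (Fin S) (Fin S) ℝ) (D : DecisionProblem A R)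
    (x : Fin S → ℕ → Ω → A) (k : Fin S) (μ : ℝ) (i j : ℕ) (ω : Ω) :
    EuclideanSpace ℝ (Fin R) :=
  WithLp.toLp 2 fun r => arrayEntry b D x k μ r i j ω

/-- The centred row sum `∑_{j=1}^i [q_k(i,j) - 𝔼 q_k(i,j)]`. -/
def centredRowSum [MeasurableSpace Ω] (P : Measure Ω) (b : ℕ → Matrix (Fin S) (Fin S) ℝ)
    (D : DecisionProblem A R) (x : Fin S → ℕ → Ω → A) (k : Fin S) (μ : ℝ) (i : ℕ) (ω : Ω) :
    EuclideanSpace ℝ (Fin R) :=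
  ∑ j ∈ Finset.Icc 1 i,
    (arrayVector b D x k μ i j ω - ∫ ω', arrayVector b D x k μ i j ω' ∂P)

/-- The status `z_k^{(r)}(i) = √μ ∑_{j=1}^i t_k^{(r)}(i,j)` of agent `k` in isolation. -/
def isolatedStatus (D : DecisionProblem A R) (x : Fin S → ℕ → Ω → A) (k : Fin S) (μ : ℝ)
    (i : ℕ) (ω : Ω) : EuclideanSpace ℝ (Fin R) :=
  WithLp.toLp 2 fun r =>
    √μ * ∑ j ∈ Finset.Icc 1 i, arrayEntry (isolatedWeights S) D x k μ r i j ω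

/-- The isolated status starts at zero. -/
theorem isolatedStatus_zero (D : DecisionProblem A R) (x : Fin S → ℕ → Ω → A) (k : Fin S)
    (μ : ℝ) (ω : Ω) : isolatedStatus D x k μ 0 ω = 0 := by
  ext r
  simp [isolatedStatus]

/-- The isolated status obeys the LMS recursion `z(i) = z(i-1) + μ (d(i) - z(i-1))`. -/
theorem isolatedStatus_succ (D : DecisionProblem A R) (x : Fin S → ℕ → Ω → A) (k : Fin S)
    {μ : ℝ} (hμ : 0 ≤ μ) (i : ℕ) (ω : Ω) (r : Fin R) :
    isolatedStatus D x k μ (i + 1) ω r = isolatedStatus D x k μ i ω r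
      + μ * (datum D x k r (i + 1) ω - isolatedStatus D x k μ i ω r) := by
  have h : ∀ n, isolatedStatus D x k μ n ω r
      = ∑ j ∈ Finset.range n, μ * ((1 - μ) ^ j * datum D x k r (n - j) ω) := by
    intro n
    have hr : Finset.Icc 1 n = Finset.Ico 1 (n + 1) := by
      ext j
      simp only [Finset.mem_Icc, Finset.mem_Ico]
      omega
    simp only [isolatedStatus, arrayEntry, isolatedWeights, Matrix.of_apply, ite_mul, one_mul,
      zero_mul, Finset.sum_ite_eq, Finset.mem_univ, if_true, hr, Finset.sum_Ico_eq_sum_range,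
      Finset.mul_sum, Nat.add_sub_cancel]
    refine Finset.sum_congr rfl fun j hj => ?_
    have hj' : j < n := Finset.mem_range.mp hj
    have e1 : n - (1 + j) + 1 = n - j := by omega
    have e2 : 1 + j - 1 = j := by omega
    rw [e1, e2, ← mul_assoc, ← mul_assoc, Real.mul_self_sqrt hμ, mul_assoc]
  rw [h, h, Finset.sum_range_succ']
  have e : ∑ j ∈ Finset.range i, μ * ((1 - μ) ^ (j + 1) * datum D x k r (i + 1 - (j + 1)) ω)
      = (1 - μ) * ∑ j ∈ Finset.range i, μ * ((1 - μ) ^ j * datum D x k r (i - j) ω) := by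
    rw [Finset.mul_sum]
    refine Finset.sum_congr rfl fun j _ => ?_
    rw [Nat.add_sub_add_right]
    ring
  rw [e]
  simp only [pow_zero, one_mul, Nat.sub_zero]
  ring

/-- The matrix `Λ_k`, with entries
`𝔼[(d_k^{(r₁)} - 𝔼 d_k^{(r₁)}) (d_k^{(r₂)} - 𝔼 d_k^{(r₂)})]`, where the expectation is computed
under the distribution `law` of the observations of the agent. -/
def dataCovariance [MeasurableSpace A] (D : DecisionProblem A R) (law : PMF A) :
    Matrix (Fin R) (Fin R) ℝ :=
  Matrix.of fun r₁ r₂ =>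
    ∫ a, (D.score r₁ a - ∫ a', D.score r₁ a' ∂law.toMeasure)
      * (D.score r₂ a - ∫ a', D.score r₂ a' ∂law.toMeasure) ∂law.toMeasure

/-- The Gaussian law on `ℝ^R` with mean zero and covariance matrix `C` (positive semidefinite),
as a probability measure. -/
def centredGaussian (C : Matrix (Fin R) (Fin R) ℝ) :
    ProbabilityMeasure (EuclideanSpace ℝ (Fin R)) :=
  ⟨multivariateGaussian 0 C, inferInstance⟩

/-- Convergence in distribution to `ν` in the limit `i → ∞` followed by `μ → 0⁺`: for each step
size `μ ∈ (0,1)` the variables `X μ i` converge in distribution as `i → ∞`, to some law `Q μ`,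
and `Q μ` converges weakly to `ν` as `μ → 0⁺`. -/
def TendstoInDistributionIterated {E : Type*} [TopologicalSpace E] [MeasurableSpace E]
    [OpensMeasurableSpace E] [MeasurableSpace Ω] (P : Measure Ω) [IsProbabilityMeasure P]
    (X : ℝ → ℕ → Ω → E) (ν : ProbabilityMeasure E) : Prop :=
  ∃ Q : ℝ → ProbabilityMeasure E,
    (∀ μ ∈ Set.Ioo (0 : ℝ) 1,
      TendstoInDistribution (X μ) atTop (id : E → E) (fun _ => P) (Q μ : Measure E)) ∧
    Tendsto Q (𝓝[>] 0) (𝓝 ν)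

end AdaptiveDecision

end

open MeasureTheory ProbabilityTheory Filter Topology

noncomputable section

namespace AdaptiveDecision

open scoped RealInnerProductSpace

/-! For an isolated agent the centred row sum is `∑ j < i, w_j • Y_{i-1-j}` with `w_j = √μ (1-μ)^j`
and i.i.d. centred vectors `Y_n`, bounded because the alphabet is finite.

The row sums need not converge pointwise, since the newest datum always gets the largest weight.
Reversing the order of the data preserves their law (`map_sum_range_smul_reflect`), and the reversed
sums are partial sums of an absolutely convergent series. The law of that series is `Q μ`.

The characteristic function of `Q μ` at `t` is a limit of products of `charFun ν (w_j • t)`. With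
`s` the variance along `t`, each factor differs from `exp (-w_j² s / 2)` by at most `K w_j³ ≤ K √μ
w_j²` (`exists_norm_charFun_smul_sub_exp_le`). Since `∑ w_j² = 1 / (2 - μ) ≤ 1`, the total error is
at most `K √μ`, and the Gaussian factor has variance `s / (2 - μ) → s / 2`. Lévy's continuity
theorem concludes. -/

/-! ### Estimates for characteristic functions -/

/-- Replacing each factor of a product of complex numbers of norm at most one costs at most the sum
of the errors. -/
theorem norm_prod_range_sub_prod_range_le {f g : ℕ → ℂ} (hf : ∀ j, ‖f j‖ ≤ 1)
    (hg : ∀ j, ‖g j‖ ≤ 1) (n : ℕ) :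
    ‖∏ j ∈ Finset.range n, f j - ∏ j ∈ Finset.range n, g j‖
      ≤ ∑ j ∈ Finset.range n, ‖f j - g j‖ := by
  induction n with
  | zero => simp
  | succ n ih =>
    rw [Finset.prod_range_succ, Finset.prod_range_succ, Finset.sum_range_succ]
    have hF : ‖∏ j ∈ Finset.range n, f j‖ ≤ 1 := by
      rw [norm_prod]
      exact Finset.prod_le_one (fun _ _ => norm_nonneg _) fun j _ => hf j
    calc ‖(∏ j ∈ Finset.range n, f j) * f n - (∏ j ∈ Finset.range n, g j) * g n‖
        = ‖(∏ j ∈ Finset.range n, f j - ∏ j ∈ Finset.range n, g j) * g n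
          + (∏ j ∈ Finset.range n, f j) * (f n - g n)‖ := by congr 1; ring
      _ ≤ ‖∏ j ∈ Finset.range n, f j - ∏ j ∈ Finset.range n, g j‖ * ‖g n‖
          + ‖∏ j ∈ Finset.range n, f j‖ * ‖f n - g n‖ := by
            simpa only [norm_mul] using norm_add_le
              ((∏ j ∈ Finset.range n, f j - ∏ j ∈ Finset.range n, g j) * g n)
              ((∏ j ∈ Finset.range n, f j) * (f n - g n))
      _ ≤ ‖∏ j ∈ Finset.range n, f j - ∏ j ∈ Finset.range n, g j‖ * 1 + 1 * ‖f n - g n‖ := by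
            gcongr
            exact hg n
      _ ≤ _ := by linarith

/-- Third order expansion of the characteristic function of a bounded centred law along a ray,
compared with the Gaussian law of the same variance. -/
theorem exists_norm_charFun_smul_sub_exp_le {E : Type*} [NormedAddCommGroup E]
    [InnerProductSpace ℝ E] [MeasurableSpace E] [BorelSpace E] [SecondCountableTopology E]
    {ν : Measure E} [IsProbabilityMeasure ν] {M : ℝ} (hM : ∀ᵐ y ∂ν, ‖y‖ ≤ M) (t : E)
    (hmean : ∫ y, ⟪y, t⟫ ∂ν = 0) :
    ∃ K : ℝ, ∀ c ∈ Set.Icc (0 : ℝ) 1,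
      ‖charFun ν (c • t) - Complex.exp (-(c ^ 2 * (∫ y, ⟪y, t⟫ ^ 2 ∂ν) / 2 : ℝ))‖
        ≤ K * c ^ 3 := by
  set s : ℝ := ∫ y, ⟪y, t⟫ ^ 2 ∂ν with hs
  have hs0 : 0 ≤ s := integral_nonneg fun y => sq_nonneg _
  set B : ℝ := M * ‖t‖
  have hB : ∀ᵐ y ∂ν, |⟪y, t⟫| ≤ B := by
    filter_upwards [hM] with y hy
    exact (abs_real_inner_le_norm y t).trans (mul_le_mul_of_nonneg_right hy (norm_nonneg t))
  have hB0 : 0 ≤ B := by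
    obtain ⟨y, hy⟩ := hB.exists
    exact (abs_nonneg _).trans hy
  have hi1 : Integrable (fun y => ⟪y, t⟫) ν :=
    Integrable.of_bound (by fun_prop) B (by simpa using hB)
  have hi2 : Integrable (fun y => ⟪y, t⟫ ^ 2) ν := by
    refine Integrable.of_bound (by fun_prop) (B ^ 2) ?_
    filter_upwards [hB] with y hy
    rw [Real.norm_eq_abs, abs_pow]
    gcongr
  -- The first term bounds the third-order Taylor remainder of `exp (i c ⟪y, t⟫)`, the second the
  -- second-order remainder of `exp (-c² s / 2)`; the latter is of order `c⁴ ≤ c³`.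
  refine ⟨B ^ 3 * Real.exp B + (s / 2) ^ 2 * Real.exp (s / 2), fun c hc => ?_⟩
  obtain ⟨hc0, hc1⟩ := hc
  have hie : Integrable (fun y => Complex.exp ((⟪y, c • t⟫ : ℝ) * Complex.I)) ν := by
    refine Integrable.of_bound (by fun_prop) 1 (ae_of_all _ fun y => ?_)
    rw [Complex.norm_exp_ofReal_mul_I]
  have hip : Integrable
      (fun y => 1 + (c * ⟪y, t⟫ : ℝ) * Complex.I - ((c ^ 2 * ⟪y, t⟫ ^ 2 / 2 : ℝ) : ℂ)) ν :=
    ((integrable_const _).add ((hi1.const_mul c).ofReal.mul_const _)).sub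
      ((hi2.const_mul (c ^ 2)).div_const 2).ofReal
  have hpoly : ∫ y, (1 + (c * ⟪y, t⟫ : ℝ) * Complex.I - ((c ^ 2 * ⟪y, t⟫ ^ 2 / 2 : ℝ) : ℂ)) ∂ν
      = 1 - ((c ^ 2 * s / 2 : ℝ) : ℂ) := by
    rw [integral_sub, integral_add, integral_mul_const, integral_complex_ofReal,
      integral_complex_ofReal, integral_const_mul, hmean, integral_div, integral_const_mul, ← hs]
    · simp
    · exact integrable_const _
    · exact (hi1.const_mul c).ofReal.mul_const _
    · exact (integrable_const _).add ((hi1.const_mul c).ofReal.mul_const _)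
    · exact ((hi2.const_mul (c ^ 2)).div_const 2).ofReal
  have h1 : ‖charFun ν (c • t) - (1 - ((c ^ 2 * s / 2 : ℝ) : ℂ))‖ ≤ B ^ 3 * Real.exp B * c ^ 3 := by
    rw [charFun_apply, ← hpoly, ← integral_sub hie hip]
    refine (norm_integral_le_of_norm_le_const (C := B ^ 3 * Real.exp B * c ^ 3) ?_).trans
      (by simp)
    filter_upwards [hB] with y hy
    have h := Complex.norm_exp_sub_sum_le_norm_mul_exp ((c * ⟪y, t⟫ : ℝ) * Complex.I) 3
    have hn : ‖((c * ⟪y, t⟫ : ℝ) : ℂ) * Complex.I‖ = c * |⟪y, t⟫| := by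
      rw [norm_mul, Complex.norm_I, mul_one, Complex.norm_real, Real.norm_eq_abs, abs_mul,
        abs_of_nonneg hc0]
    have e : ∑ m ∈ Finset.range 3, (((c * ⟪y, t⟫ : ℝ) : ℂ) * Complex.I) ^ m / (m.factorial : ℂ)
        = 1 + (c * ⟪y, t⟫ : ℝ) * Complex.I - ((c ^ 2 * ⟪y, t⟫ ^ 2 / 2 : ℝ) : ℂ) := by
      simp only [Finset.sum_range_succ, Finset.sum_range_zero, mul_pow, Complex.I_sq]
      norm_num [Nat.factorial]
      ring
    rw [hn, e] at h
    rw [inner_smul_right]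
    refine h.trans ?_
    have hcb : c * |⟪y, t⟫| ≤ B := by nlinarith [abs_nonneg (⟪y, t⟫ : ℝ)]
    calc (c * |⟪y, t⟫|) ^ 3 * Real.exp (c * |⟪y, t⟫|) ≤ (c * B) ^ 3 * Real.exp B := by gcongr
      _ = B ^ 3 * Real.exp B * c ^ 3 := by ring
  have h2 : ‖(1 - ((c ^ 2 * s / 2 : ℝ) : ℂ)) - Complex.exp (-(c ^ 2 * s / 2 : ℝ))‖
      ≤ (s / 2) ^ 2 * Real.exp (s / 2) * c ^ 3 := by
    have h := Complex.norm_exp_sub_sum_le_norm_mul_exp (-(c ^ 2 * s / 2 : ℝ)) 2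
    have hn : ‖(-((c ^ 2 * s / 2 : ℝ) : ℂ))‖ = c ^ 2 * (s / 2) := by
      rw [norm_neg, Complex.norm_real, Real.norm_eq_abs, abs_of_nonneg (by positivity)]
      ring
    have e : ∑ m ∈ Finset.range 2, (-((c ^ 2 * s / 2 : ℝ) : ℂ)) ^ m / (m.factorial : ℂ)
        = 1 - ((c ^ 2 * s / 2 : ℝ) : ℂ) := by
      simp [Finset.sum_range_succ, sub_eq_add_neg]
    rw [hn, e] at h
    rw [norm_sub_rev]
    refine h.trans ?_
    have hc2 : c ^ 2 * (s / 2) ≤ s / 2 :=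
      mul_le_of_le_one_left (by positivity) (pow_le_one₀ hc0 hc1)
    calc (c ^ 2 * (s / 2)) ^ 2 * Real.exp (c ^ 2 * (s / 2))
        ≤ (c ^ 2 * (s / 2)) ^ 2 * Real.exp (s / 2) := by gcongr
      _ = (s / 2) ^ 2 * Real.exp (s / 2) * c ^ 4 := by ring
      _ ≤ (s / 2) ^ 2 * Real.exp (s / 2) * c ^ 3 := by
        have : c ^ 4 ≤ c ^ 3 := pow_le_pow_of_le_one hc0 hc1 (by norm_num)
        gcongr
  calc ‖charFun ν (c • t) - Complex.exp (-(c ^ 2 * s / 2 : ℝ))‖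
      ≤ ‖charFun ν (c • t) - (1 - ((c ^ 2 * s / 2 : ℝ) : ℂ))‖
        + ‖(1 - ((c ^ 2 * s / 2 : ℝ) : ℂ)) - Complex.exp (-(c ^ 2 * s / 2 : ℝ))‖ :=
        norm_sub_le_norm_sub_add_norm_sub _ _ _
    _ ≤ _ := by rw [add_mul]; exact add_le_add h1 h2

/-! ### Exponential weights and the Gaussian comparison -/

/-- The weights `√μ (1-μ)^j` of the exponentially weighted sums. -/
def expWeight (μ : ℝ) (j : ℕ) : ℝ := √μ * (1 - μ) ^ j

theorem expWeight_nonneg {μ : ℝ} (hμ : μ ∈ Set.Ioo (0 : ℝ) 1) (j : ℕ) : 0 ≤ expWeight μ j :=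
  mul_nonneg (Real.sqrt_nonneg _) (pow_nonneg (by linarith [hμ.2]) _)

theorem expWeight_le_sqrt {μ : ℝ} (hμ : μ ∈ Set.Ioo (0 : ℝ) 1) (j : ℕ) : expWeight μ j ≤ √μ :=
  mul_le_of_le_one_right (Real.sqrt_nonneg _)
    (pow_le_one₀ (by linarith [hμ.2]) (by linarith [hμ.1]))

theorem expWeight_le_one {μ : ℝ} (hμ : μ ∈ Set.Ioo (0 : ℝ) 1) (j : ℕ) : expWeight μ j ≤ 1 :=
  (expWeight_le_sqrt hμ j).trans (Real.sqrt_le_one.mpr hμ.2.le)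

theorem summable_expWeight {μ : ℝ} (hμ : μ ∈ Set.Ioo (0 : ℝ) 1) : Summable (expWeight μ) :=
  (summable_geometric_of_lt_one (by linarith [hμ.2]) (by linarith [hμ.1])).mul_left _

/-- A geometric series of ratio `(1-μ)²`: the factor `μ` cancels in `1 - (1-μ)² = μ (2-μ)`. Its
limit `1/2` as `μ → 0` is the factor in the limiting covariance. -/
theorem hasSum_expWeight_sq {μ : ℝ} (hμ : μ ∈ Set.Ioo (0 : ℝ) 1) :
    HasSum (fun j => expWeight μ j ^ 2) (2 - μ)⁻¹ := by
  obtain ⟨h0, h1⟩ := hμ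
  have h := (hasSum_geometric_of_lt_one (r := (1 - μ) ^ 2) (by positivity) (by nlinarith)).mul_left μ
  have e : μ * (1 - (1 - μ) ^ 2)⁻¹ = (2 - μ)⁻¹ := by
    have e1 : 1 - (1 - μ) ^ 2 = μ * (2 - μ) := by ring
    rw [e1, mul_inv, ← mul_assoc, mul_inv_cancel₀ h0.ne', one_mul]
  rw [e] at h
  have e2 : (fun j => expWeight μ j ^ 2) = fun j => μ * ((1 - μ) ^ 2) ^ j := by
    funext j
    rw [expWeight, mul_pow, Real.sq_sqrt h0.le, pow_right_comm]
  rwa [e2]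

/-- The limit, as the number of factors grows, of the products of characteristic functions is
within `K √μ` of a Gaussian characteristic function. -/
theorem exists_norm_sub_exp_le_of_tendsto_prod_charFun {E : Type*} [NormedAddCommGroup E]
    [InnerProductSpace ℝ E] [MeasurableSpace E] [BorelSpace E] [SecondCountableTopology E]
    {ν : Measure E} [IsProbabilityMeasure ν] {M : ℝ} (hM : ∀ᵐ y ∂ν, ‖y‖ ≤ M) (t : E)
    (hmean : ∫ y, ⟪y, t⟫ ∂ν = 0) :
    ∃ K : ℝ, ∀ μ ∈ Set.Ioo (0 : ℝ) 1, ∀ z : ℂ,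
      Tendsto (fun n => ∏ j ∈ Finset.range n, charFun ν (expWeight μ j • t)) atTop (𝓝 z) →
      ‖z - Complex.exp (-((2 - μ)⁻¹ * ((∫ y, ⟪y, t⟫ ^ 2 ∂ν) / 2) : ℝ))‖ ≤ K * √μ := by
  obtain ⟨K, hK⟩ := exists_norm_charFun_smul_sub_exp_le hM t hmean
  set s : ℝ := ∫ y, ⟪y, t⟫ ^ 2 ∂ν with hs
  have hs0 : 0 ≤ s := integral_nonneg fun y => sq_nonneg _
  -- At `c = 1` the bound reads `0 ≤ ‖…‖ ≤ K`.
  have hK0 : 0 ≤ K := by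
    have := (norm_nonneg _).trans (hK 1 ⟨zero_le_one, le_rfl⟩)
    simpa using this
  refine ⟨K, fun μ hμ z hz => ?_⟩
  have hsq := hasSum_expWeight_sq hμ
  have hexp : Tendsto (fun n => ∏ j ∈ Finset.range n,
      Complex.exp (-(expWeight μ j ^ 2 * s / 2 : ℝ))) atTop
      (𝓝 (Complex.exp (-((2 - μ)⁻¹ * (s / 2) : ℝ)))) := by
    have h := ((hsq.mul_right (s / 2)).tendsto_sum_nat).neg
    have h' := (Complex.continuous_exp.comp Complex.continuous_ofReal).continuousAt.tendsto.comp h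
    simp only [Function.comp_def, Complex.ofReal_neg] at h'
    refine h'.congr fun n => ?_
    rw [← Complex.exp_sum, Finset.sum_neg_distrib, Complex.ofReal_sum]
    simp only [mul_div_assoc]
  refine le_of_tendsto (hz.sub hexp).norm (Eventually.of_forall fun n => ?_)
  calc _ ≤ ∑ j ∈ Finset.range n, ‖charFun ν (expWeight μ j • t)
          - Complex.exp (-(expWeight μ j ^ 2 * s / 2 : ℝ))‖ := by
        refine norm_prod_range_sub_prod_range_le (fun _ => norm_charFun_le_one _) (fun j => ?_) n
        rw [← Complex.ofReal_neg, Complex.norm_exp_ofReal, Real.exp_le_one_iff]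
        exact neg_nonpos.mpr (by positivity)
    _ ≤ ∑ j ∈ Finset.range n, K * √μ * expWeight μ j ^ 2 := by
        refine Finset.sum_le_sum fun j _ =>
          (hK _ ⟨expWeight_nonneg hμ j, expWeight_le_one hμ j⟩).trans ?_
        -- Of the three factors in `w_j³`, one is bounded by `√μ` and the other two are kept for the
        -- summable squares.
        rw [pow_succ', ← mul_assoc]
        gcongr
        exact expWeight_le_sqrt hμ j
    _ = K * √μ * ∑ j ∈ Finset.range n, expWeight μ j ^ 2 := by rw [Finset.mul_sum]
    _ ≤ K * √μ * 1 := by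
        gcongr
        exact (sum_le_hasSum _ (fun _ _ => sq_nonneg _) hsq).trans
          (inv_le_one_of_one_le₀ (by linarith [hμ.2]))
    _ = K * √μ := mul_one _

/-! ### Weighted sums of i.i.d. bounded vectors -/

section WeightedSums

variable {E Ω : Type*} [NormedAddCommGroup E] [InnerProductSpace ℝ E] [MeasurableSpace E]
  [BorelSpace E] [SecondCountableTopology E] [MeasurableSpace Ω] {P : Measure Ω}
  {Y : ℕ → Ω → E} {ν : Measure E}

theorem charFun_map_sum_range_smul (hY : ∀ n, Measurable (Y n)) (hν : ∀ n, P.map (Y n) = ν)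
    (hindep : iIndepFun Y P) (c : ℕ → ℝ) (n : ℕ) (t : E) :
    charFun (P.map fun ω => ∑ j ∈ Finset.range n, c j • Y j ω) t
      = ∏ j ∈ Finset.range n, charFun ν (c j • t) := by
  have hi : iIndepFun (fun j ω => c j • Y j ω) P :=
    hindep.comp (fun j y => c j • y) fun j => by fun_prop
  rw [iIndepFun.charFun_map_fun_finsetSum_eq_prod (X := fun j ω => c j • Y j ω)
    (fun j _ => ((hY j).const_smul (c j)).aemeasurable) (hi.restrict _), Finset.prod_apply]
  exact Finset.prod_congr rfl fun j _ => by
    rw [charFun_map_smul_comp (hY j).aemeasurable, hν]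

theorem sum_range_smul_reflect {F : Type*} [AddCommGroup F] [Module ℝ F] (c : ℕ → ℝ) (y : ℕ → F)
    (n : ℕ) :
    ∑ j ∈ Finset.range n, c j • y (n - 1 - j) = ∑ j ∈ Finset.range n, c (n - 1 - j) • y j := by
  rw [← Finset.sum_range_reflect fun j => c (n - 1 - j) • y j]
  refine Finset.sum_congr rfl fun j hj => ?_
  rw [Nat.sub_sub_self (by have := Finset.mem_range.mp hj; omega)]

/-- Moving the reversal onto the weights only permutes the factors of the product of characteristic
functions, as all `Y n` share one law. -/
theorem map_sum_range_smul_reflect [CompleteSpace E] [IsProbabilityMeasure P]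
    (hY : ∀ n, Measurable (Y n)) (hν : ∀ n, P.map (Y n) = ν)
    (hindep : iIndepFun Y P) (c : ℕ → ℝ) (n : ℕ) :
    (P.map fun ω => ∑ j ∈ Finset.range n, c j • Y (n - 1 - j) ω)
      = P.map fun ω => ∑ j ∈ Finset.range n, c j • Y j ω := by
  refine Measure.ext_of_charFun (funext fun t => ?_)
  have e : (fun ω => ∑ j ∈ Finset.range n, c j • Y (n - 1 - j) ω)
      = fun ω => ∑ j ∈ Finset.range n, c (n - 1 - j) • Y j ω :=
    funext fun ω => sum_range_smul_reflect c (fun j => Y j ω) n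
  rw [e, charFun_map_sum_range_smul hY hν hindep, charFun_map_sum_range_smul hY hν hindep,
    Finset.prod_range_reflect (fun j => charFun ν (c j • t))]

/-- Exponentially weighted sums of bounded, centred, independent and identically distributed
vectors are asymptotically Gaussian, with half the variance of the summands, in the iterated limit
of a growing number of terms followed by a vanishing step size. -/
theorem tendstoInDistributionIterated_of_eq_expWeight_sum [FiniteDimensional ℝ E]
    [IsProbabilityMeasure P]
    (hY : ∀ n, Measurable (Y n)) (hν : ∀ n, P.map (Y n) = ν)
    (hindep : iIndepFun Y P) {M : ℝ} (hM : ∀ n ω, ‖Y n ω‖ ≤ M)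
    (hmean : ∀ t : E, ∫ y, ⟪y, t⟫ ∂ν = 0)
    {X : ℝ → ℕ → Ω → E} (hX : ∀ μ ∈ Set.Ioo (0 : ℝ) 1, ∀ n ω,
      X μ n ω = ∑ j ∈ Finset.range n, expWeight μ j • Y (n - 1 - j) ω)
    {G : ProbabilityMeasure E}
    (hG : ∀ t : E, charFun (G : Measure E) t
      = Complex.exp (-(2⁻¹ * ((∫ y, ⟪y, t⟫ ^ 2 ∂ν) / 2) : ℝ))) :
    TendstoInDistributionIterated P X G := by
  have : CompleteSpace E := FiniteDimensional.complete ℝ E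
  have hνP : IsProbabilityMeasure ν := by
    rw [← hν 0]
    exact Measure.isProbabilityMeasure_map (hY 0).aemeasurable
  have hνM : ∀ᵐ y ∂ν, ‖y‖ ≤ M := by
    rw [← hν 0, ae_map_iff (hY 0).aemeasurable (measurableSet_le measurable_norm measurable_const)]
    exact ae_of_all _ (hM 0)
  have hlim : ∀ μ ∈ Set.Ioo (0 : ℝ) 1, ∃ Q : ProbabilityMeasure E,
      TendstoInDistribution (X μ) atTop (id : E → E) (fun _ => P) (Q : Measure E) := by
    intro μ hμ
    have hsum : ∀ ω, Tendsto (fun n => ∑ j ∈ Finset.range n, expWeight μ j • Y j ω) atTop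
        (𝓝 (∑' j, expWeight μ j • Y j ω)) := by
      intro ω
      refine (Summable.of_norm_bounded ((summable_expWeight hμ).mul_right M)
        fun j => ?_).hasSum.tendsto_sum_nat
      rw [norm_smul, Real.norm_of_nonneg (expWeight_nonneg hμ j)]
      exact mul_le_mul_of_nonneg_left (hM j ω) (expWeight_nonneg hμ j)
    have hmeas : ∀ n, Measurable fun ω => ∑ j ∈ Finset.range n, expWeight μ j • Y j ω :=
      fun n => Finset.measurable_fun_sum _ fun j _ => (hY j).const_smul _
    have hmeasX : ∀ n, Measurable (X μ n) := fun n => by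
      rw [funext (hX μ hμ n)]
      exact Finset.measurable_fun_sum _ fun j _ => (hY _).const_smul _
    have hZ : Measurable fun ω => ∑' j, expWeight μ j • Y j ω :=
      measurable_of_tendsto_metrizable hmeas (tendsto_pi_nhds.mpr hsum)
    have h := tendstoInDistribution_of_ae_tendsto (μ' := P) (fun n => (hmeas n).aemeasurable)
      hZ.aemeasurable (ae_of_all _ hsum)
    let Q : ProbabilityMeasure E := ⟨P.map _, Measure.isProbabilityMeasure_map hZ.aemeasurable⟩
    refine ⟨Q, fun n => (hmeasX n).aemeasurable, aemeasurable_id, ?_⟩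
    have hid : (⟨(Q : Measure E).map id, Measure.isProbabilityMeasure_map aemeasurable_id⟩ :
        ProbabilityMeasure E) = Q := Subtype.ext Measure.map_id
    rw [hid]
    refine h.tendsto.congr fun n => Subtype.ext ?_
    change P.map _ = P.map (X μ n)
    rw [funext (hX μ hμ n)]
    exact (map_sum_range_smul_reflect hY hν hindep _ n).symm
  -- `choose!` makes `Q` total on `ℝ`; its values outside `(0,1)` are irrelevant to the limit along
  -- `𝓝[>] 0`.
  have : Nonempty (ProbabilityMeasure E) := ⟨G⟩
  choose! Q hQ using hlim
  refine ⟨Q, hQ, ?_⟩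
  have hchar : ∀ t : E, Tendsto (fun μ => charFun (Q μ : Measure E) t) (𝓝[>] 0)
      (𝓝 (charFun (G : Measure E) t)) := by
    intro t
    obtain ⟨K, hK⟩ := exists_norm_sub_exp_le_of_tendsto_prod_charFun hνM t (hmean t)
    have hexp : Tendsto
        (fun μ : ℝ => Complex.exp (-((2 - μ)⁻¹ * ((∫ y, ⟪y, t⟫ ^ 2 ∂ν) / 2) : ℝ))) (𝓝[>] 0)
        (𝓝 (charFun (G : Measure E) t)) := by
      rw [hG t]
      have hc : ContinuousAt
          (fun μ : ℝ => Complex.exp (-((2 - μ)⁻¹ * ((∫ y, ⟪y, t⟫ ^ 2 ∂ν) / 2) : ℝ))) 0 := by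
        have : ContinuousAt (fun μ : ℝ => (2 - μ)⁻¹) 0 :=
          (continuousAt_const.sub continuousAt_id).inv₀ (by simp)
        fun_prop
      simpa only [sub_zero] using hc.tendsto.mono_left nhdsWithin_le_nhds
    have hdiff : Tendsto (fun μ => charFun (Q μ : Measure E) t
        - Complex.exp (-((2 - μ)⁻¹ * ((∫ y, ⟪y, t⟫ ^ 2 ∂ν) / 2) : ℝ))) (𝓝[>] 0) (𝓝 0) := by
      have hsqrt : Tendsto (fun μ : ℝ => K * √μ) (𝓝[>] 0) (𝓝 0) := by
        have : ContinuousAt (fun μ : ℝ => K * √μ) 0 := by fun_prop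
        simpa using this.tendsto.mono_left nhdsWithin_le_nhds
      refine squeeze_zero_norm' ?_ hsqrt
      filter_upwards [Ioo_mem_nhdsGT (zero_lt_one' ℝ)] with μ hμ
      refine hK μ hμ _ ?_
      have h := ProbabilityMeasure.tendsto_iff_tendsto_charFun.mp (hQ μ hμ).tendsto t
      simp only [ProbabilityMeasure.coe_mk, Measure.map_id] at h
      refine h.congr fun n => ?_
      rw [funext (hX μ hμ n), map_sum_range_smul_reflect hY hν hindep,
        charFun_map_sum_range_smul hY hν hindep]
    simpa using hdiff.add hexp
  -- `𝓝[>] 0` is countably generated, so Lévy's theorem along sequences suffices.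
  exact tendsto_of_seq_tendsto fun u hu =>
    ProbabilityMeasure.tendsto_iff_tendsto_charFun.mpr fun t => (hchar t).comp hu

end WeightedSums

/-! ### The data of an isolated agent -/

section Scores

variable {A Ω : Type*} {R S : ℕ}

/-- The vector of the statistics of all branches. -/
def scoreVector (D : DecisionProblem A R) (a : A) : EuclideanSpace ℝ (Fin R) :=
  WithLp.toLp 2 fun r => D.score r a

theorem arrayVector_isolatedWeights (D : DecisionProblem A R) (x : Fin S → ℕ → Ω → A)
    (k : Fin S) (μ : ℝ) (i j : ℕ) (ω : Ω) :
    arrayVector (isolatedWeights S) D x k μ i j ω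
      = expWeight μ (j - 1) • scoreVector D (x k (i - j + 1) ω) := by
  ext r
  simp [arrayVector, arrayEntry, isolatedWeights, expWeight, scoreVector, datum]

theorem isolatedStatus_eq_smul_sum (D : DecisionProblem A R) (x : Fin S → ℕ → Ω → A)
    (k : Fin S) (μ : ℝ) (i : ℕ) (ω : Ω) :
    isolatedStatus D x k μ i ω
      = √μ • ∑ j ∈ Finset.Icc 1 i, arrayVector (isolatedWeights S) D x k μ i j ω := by
  ext r
  simp [isolatedStatus, arrayVector]

variable [MeasurableSpace A]

/-- The vector of the statistics of all branches, centred under `law`. -/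
def centredScoreVector (D : DecisionProblem A R) (law : PMF A) (a : A) :
    EuclideanSpace ℝ (Fin R) :=
  scoreVector D a - ∫ a', scoreVector D a' ∂law.toMeasure

variable [Fintype A] [MeasurableSingletonClass A]

theorem integral_centredScoreVector (D : DecisionProblem A R) (law : PMF A) :
    ∫ a, centredScoreVector D law a ∂law.toMeasure = 0 := by
  unfold centredScoreVector
  rw [integral_sub .of_finite (integrable_const _)]
  simp

/-- Coordinate projections are continuous and linear, so they commute with the vector-valued
integral. -/
theorem centredScoreVector_apply (D : DecisionProblem A R) (law : PMF A) (a : A) (r : Fin R) :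
    centredScoreVector D law a r
      = D.score r a - ∫ a', D.score r a' ∂law.toMeasure := by
  have h := (EuclideanSpace.proj r : EuclideanSpace ℝ (Fin R) →L[ℝ] ℝ).integral_comp_comm
    (Integrable.of_finite (μ := law.toMeasure) (f := scoreVector D))
  simp only [EuclideanSpace.coe_proj] at h
  rw [centredScoreVector, PiLp.sub_apply, ← h]
  rfl

/-- This identifies the variance along `t` with the quadratic form of the covariance matrix; it
gives both positive semidefiniteness and the Gaussian exponent. -/
theorem dotProduct_dataCovariance_mulVec (D : DecisionProblem A R) (law : PMF A)
    (t : EuclideanSpace ℝ (Fin R)) :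
    t.ofLp ⬝ᵥ (dataCovariance D law).mulVec t.ofLp
      = ∫ a, ⟪centredScoreVector D law a, t⟫ ^ 2 ∂law.toMeasure := by
  have h : ∀ a, ⟪centredScoreVector D law a, t⟫ ^ 2 = ∑ r₁, ∑ r₂,
      t r₁ * (centredScoreVector D law a r₁ * centredScoreVector D law a r₂ * t r₂) := by
    intro a
    rw [PiLp.inner_apply, sq, Finset.sum_mul_sum]
    refine Finset.sum_congr rfl fun r₁ _ => Finset.sum_congr rfl fun r₂ _ => ?_
    simp only [RCLike.inner_apply, conj_trivial]
    ring
  simp_rw [h]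
  rw [integral_finsetSum _ fun _ _ => .of_finite]
  simp_rw [dotProduct, Matrix.mulVec, dotProduct, Finset.mul_sum]
  refine Finset.sum_congr rfl fun r₁ _ => ?_
  rw [integral_finsetSum _ fun _ _ => .of_finite]
  refine Finset.sum_congr rfl fun r₂ _ => ?_
  rw [integral_const_mul, integral_mul_const]
  simp_rw [centredScoreVector_apply]
  rfl

theorem posSemidef_dataCovariance (D : DecisionProblem A R) (law : PMF A) :
    (dataCovariance D law).PosSemidef := by
  refine Matrix.PosSemidef.of_dotProduct_mulVec_nonneg ?_ fun t => ?_
  · ext r₁ r₂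
    simp only [Matrix.conjTranspose_apply, dataCovariance, Matrix.of_apply, star_trivial]
    exact integral_congr_ae (ae_of_all _ fun a => mul_comm _ _)
  · have h := dotProduct_dataCovariance_mulVec D law (WithLp.toLp 2 t)
    rw [star_trivial]
    exact h ▸ integral_nonneg fun a => sq_nonneg _

/-- The factor `2⁻¹` is the limit of `(2 - μ)⁻¹`; the division by 2 belongs to the Gaussian
characteristic function. -/
theorem charFun_centredGaussian_half_dataCovariance (D : DecisionProblem A R) (law : PMF A)
    (t : EuclideanSpace ℝ (Fin R)) :
    charFun (centredGaussian ((1 / 2 : ℝ) • dataCovariance D law) :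
        Measure (EuclideanSpace ℝ (Fin R))) t
      = Complex.exp (-(2⁻¹ *
        ((∫ y, ⟪y, t⟫ ^ 2 ∂law.toMeasure.map (centredScoreVector D law)) / 2) : ℝ)) := by
  have hps : ((1 / 2 : ℝ) • dataCovariance D law).PosSemidef :=
    (posSemidef_dataCovariance D law).smul (by norm_num)
  rw [integral_map (measurable_of_finite _).aemeasurable (by fun_prop),
    ← dotProduct_dataCovariance_mulVec]
  change charFun (multivariateGaussian 0 _) t = _
  rw [charFun_multivariateGaussian hps, Matrix.smul_mulVec, dotProduct_smul]
  congr 1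
  simp
  ring

variable [MeasurableSpace Ω] {P : Measure Ω} {x : Fin S → ℕ → Ω → A} {law : Fin S → PMF A}

theorem integral_arrayVector_isolatedWeights [IsProbabilityMeasure P] (D : DecisionProblem A R)
    (hx : ∀ ℓ i, 1 ≤ i → Measurable (x ℓ i))
    (hlaw : ∀ ℓ i, 1 ≤ i → P.map (x ℓ i) = (law ℓ).toMeasure) (k : Fin S) (μ : ℝ) (i j : ℕ) :
    ∫ ω, arrayVector (isolatedWeights S) D x k μ i j ω ∂P
      = expWeight μ (j - 1) • ∫ a, scoreVector D a ∂(law k).toMeasure := by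
  simp_rw [arrayVector_isolatedWeights]
  -- With truncated subtraction `i - j + 1 ≥ 1` even for `j > i`, so the time index is always
  -- admissible.
  rw [integral_smul, ← hlaw k (i - j + 1) (by omega),
    integral_map (hx k _ (by omega)).aemeasurable (measurable_of_finite _).aestronglyMeasurable]

theorem integrable_arrayVector_isolatedWeights [IsProbabilityMeasure P] (D : DecisionProblem A R)
    (hx : ∀ ℓ i, 1 ≤ i → Measurable (x ℓ i)) (k : Fin S) (μ : ℝ) (i j : ℕ) :
    Integrable (arrayVector (isolatedWeights S) D x k μ i j) P := by
  rw [funext (arrayVector_isolatedWeights D x k μ i j)]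
  exact ((Integrable.of_finite (f := scoreVector D)).comp_measurable
    (hx k _ (Nat.le_add_left 1 (i - j)))).smul (expWeight μ (j - 1))

theorem centredRowSum_isolatedWeights [IsProbabilityMeasure P] (D : DecisionProblem A R)
    (hx : ∀ ℓ i, 1 ≤ i → Measurable (x ℓ i))
    (hlaw : ∀ ℓ i, 1 ≤ i → P.map (x ℓ i) = (law ℓ).toMeasure) (k : Fin S) (μ : ℝ) (i : ℕ)
    (ω : Ω) :
    centredRowSum P (isolatedWeights S) D x k μ i ω
      = ∑ j ∈ Finset.range i,
        expWeight μ j • centredScoreVector D (law k) (x k (i - 1 - j + 1) ω) := by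
  simp_rw [centredRowSum, integral_arrayVector_isolatedWeights D hx hlaw,
    arrayVector_isolatedWeights, ← smul_sub]
  rw [← Finset.Ico_succ_right_eq_Icc, Finset.sum_Ico_eq_sum_range]
  refine Finset.sum_congr (by simp) fun j _ => ?_
  rw [Nat.add_sub_cancel_left, Nat.sub_sub]
  rfl

theorem inv_sqrt_smul_isolatedStatus_sub_integral [IsProbabilityMeasure P]
    (D : DecisionProblem A R) (hx : ∀ ℓ i, 1 ≤ i → Measurable (x ℓ i)) (k : Fin S)
    {μ : ℝ} (hμ : 0 < μ) (i : ℕ) (ω : Ω) :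
    (√μ)⁻¹ • (isolatedStatus D x k μ i ω - ∫ ω', isolatedStatus D x k μ i ω' ∂P)
      = centredRowSum P (isolatedWeights S) D x k μ i ω := by
  simp_rw [isolatedStatus_eq_smul_sum]
  rw [integral_smul,
    integral_finsetSum _ fun j _ => integrable_arrayVector_isolatedWeights D hx k μ i j,
    ← smul_sub, smul_smul, inv_mul_cancel₀ (Real.sqrt_pos.mpr hμ).ne', one_smul,
    ← Finset.sum_sub_distrib]
  rfl

/-- Any family that agrees with the centred row sums of an isolated agent for step sizes in `(0,1)`
is asymptotically Gaussian in the iterated limit. -/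
theorem tendstoInDistributionIterated_of_eq_centredRowSum [IsProbabilityMeasure P]
    (D : DecisionProblem A R) (hx : ∀ ℓ i, 1 ≤ i → Measurable (x ℓ i))
    (hlaw : ∀ ℓ i, 1 ≤ i → P.map (x ℓ i) = (law ℓ).toMeasure)
    (hindep : iIndepFun (fun (q : Fin S × {i : ℕ // 1 ≤ i}) => x q.1 q.2) P) (k : Fin S)
    {X : ℝ → ℕ → Ω → EuclideanSpace ℝ (Fin R)}
    (hX : ∀ μ ∈ Set.Ioo (0 : ℝ) 1, ∀ n ω,
      X μ n ω = centredRowSum P (isolatedWeights S) D x k μ n ω) :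
    TendstoInDistributionIterated P X
      (centredGaussian ((1 / 2 : ℝ) • dataCovariance D (law k))) := by
  have hxk : ∀ n, Measurable (x k (n + 1)) := fun n => hx k _ (Nat.le_add_left 1 n)
  have hV : Measurable (centredScoreVector D (law k)) := measurable_of_finite _
  -- Observations start at time 1, so the sequence indexed from 0 is shifted by one.
  have hind : iIndepFun (fun n ω => centredScoreVector D (law k) (x k (n + 1) ω)) P := by
    have hinj : Function.Injective
        fun n : ℕ => ((k, ⟨n + 1, Nat.le_add_left 1 n⟩) : Fin S × {i : ℕ // 1 ≤ i}) := by
      intro m n h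
      simpa using h
    exact (hindep.precomp hinj).comp (fun _ => centredScoreVector D (law k)) fun _ => hV
  have hlawV : ∀ n, P.map (fun ω => centredScoreVector D (law k) (x k (n + 1) ω))
      = (law k).toMeasure.map (centredScoreVector D (law k)) := fun n => by
    rw [← hlaw k _ (Nat.le_add_left 1 n), Measure.map_map hV (hxk n)]
    rfl
  have hmean : ∀ t : EuclideanSpace ℝ (Fin R),
      ∫ y, inner ℝ y t ∂(law k).toMeasure.map (centredScoreVector D (law k)) = 0 := by
    intro t
    rw [integral_map hV.aemeasurable (by fun_prop)]
    simp_rw [real_inner_comm t]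
    rw [integral_inner .of_finite, integral_centredScoreVector, inner_zero_right]
  obtain ⟨M, hM⟩ := Set.Finite.bddAbove
    (Set.finite_range fun a => ‖centredScoreVector D (law k) a‖)
  exact tendstoInDistributionIterated_of_eq_expWeight_sum (fun n => hV.comp (hxk n)) hlawV hind
    (fun n ω => hM ⟨x k (n + 1) ω, rfl⟩) hmean
    (fun μ hμ n ω => (hX μ hμ n ω).trans (centredRowSum_isolatedWeights D hx hlaw k μ n ω))
    (charFun_centredGaussian_half_dataCovariance D (law k))

end Scores

end AdaptiveDecision

end

theorem corollary1 {A Ω : Type*} [Fintype A] [MeasurableSpace A] [MeasurableSingletonClass A]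
    [MeasurableSpace Ω] (P : Measure Ω) [IsProbabilityMeasure P] {R S : ℕ}
    -- the decision problem and the distribution of the observations of each agent
    (D : AdaptiveDecision.DecisionProblem A R) (law : Fin S → PMF A) (hD : D.Admits law)
    -- the observations `x ℓ i` of agent `ℓ` at time `i ≥ 1`: independent, stationary in time
    (x : Fin S → ℕ → Ω → A)
    (hx : ∀ ℓ i, 1 ≤ i → Measurable (x ℓ i))
    (hlaw : ∀ ℓ i, 1 ≤ i → P.map (x ℓ i) = (law ℓ).toMeasure)
    (hindep : iIndepFun (fun (q : Fin S × {i : ℕ // 1 ≤ i}) => x q.1 q.2) P)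
    (k : Fin S) :
    AdaptiveDecision.TendstoInDistributionIterated P
      (AdaptiveDecision.centredRowSum P (AdaptiveDecision.isolatedWeights S) D x k)
      (AdaptiveDecision.centredGaussian
        ((1 / 2 : ℝ) • AdaptiveDecision.dataCovariance D (law k))) ∧
    AdaptiveDecision.TendstoInDistributionIterated P
      (fun μ i ω => (√μ)⁻¹ • (AdaptiveDecision.isolatedStatus D x k μ i ω
        - ∫ ω', AdaptiveDecision.isolatedStatus D x k μ i ω' ∂P))
      (AdaptiveDecision.centredGaussian
        ((1 / 2 : ℝ) • AdaptiveDecision.dataCovariance D (law k))) :=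
  ⟨AdaptiveDecision.tendstoInDistributionIterated_of_eq_centredRowSum D hx hlaw hindep k
      fun _ _ _ _ => rfl,
    AdaptiveDecision.tendstoInDistributionIterated_of_eq_centredRowSum D hx hlaw hindep k
      fun _ hμ n ω =>
        AdaptiveDecision.inv_sqrt_smul_isolatedStatus_sub_integral D hx k hμ.1 n ω⟩
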